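/- Let $\mathbb F_q$ be a finite field with $q$ elements and algebraic closure $\overline{\mathbb F}_q$, let $\ell$ be a prime with $\ell\nmid q(q-1)$, and let $a\ge 1$ be an integer. Let $E/\mathbb F_q$ be an elliptic curve such that $\ell$ divides $|E(\mathbb F_q)|$ but $\ell^2$ does not. Let $\sigma_E$ be the $q$-th power Frobenius endomorphism of $E$, with trace $t=q+1-|E(\mathbb F_q)|$. Let $\lambda,\mu\in\{0,1,\dots,\ell^{a+1}-1\}$ satisfy $X^2-tX+q\equiv (X-\lambda)(X-\mu) \pmod{\ell^{a+1}}$, $\lambda\equiv 1 \pmod \ell$ and $\mu\equiv q\pmod \ell$. Let $P_\lambda,P_\mu\in E(\overline{\mathbb F}_q)$ be points of order $\ell^{a+1}$ such that $\sigma_E P_\lambda=\lambda P_\lambda$, $\sigma_E P_\mu=\mu P_\mu$ and $E(\overline{\mathbb F}_q)[\ell^{a+1}]=\langle P_\lambda\rangle\oplus\langle P_\mu\rangle$. For a point $P$ write $\Sigma.P=\{P,\sigma_E P,\dots,\sigma_E^{\ell^a-1}P\}$, and let $\mathrm{Tr}_E:E(\mathbb F_{q^{\ell^a}})\to E(\mathbb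 F_{q^{\ell^a}})$ be the map $P\mapsto\sum_{j=0}^{\ell^a-1}\sigma_E^jP$. Then: 1. For all $P_1,P_2\in E(\mathbb F_{q^{\ell^a}})$ lying in $\langle P_\lambda\rangle\setminus\langle \ell P_\lambda\rangle$, $\mathrm{Tr}_E(P_1)=\mathrm{Tr}_E(P_2)$ if and only if $\Sigma.P_1=\Sigma.P_2$. 2. $E(\mathbb F_{q^{\ell^a}})[\ell^{a+1}]=\langle P_\lambda\rangle$; in particular every point of $\langle P_\lambda\rangle$ lies in $E(\mathbb F_{q^{\ell^a}})$. 3. $\langle P_\lambda\rangle\setminus\langle \ell P_\lambda\rangle=\bigcup_{z=1}^{\ell-1}\Sigma.zP_\lambda$, and the sets $\Sigma.zP_\lambda$, $1\le z\le\ell-1$, are pairwise disjoint. -/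

import Mathlib

namespace FrobTrace

variable {F : Type*} [Field F] [Fintype F]

/-- The group `E(L)` of points of a Weierstrass curve `E` over `F` with coordinates in an
extension field `L` of `F`. -/
abbrev Pts (E : WeierstrassCurve F) (L : Type*) [Field L] [Algebra F L] : Type _ :=
  (WeierstrassCurve.Affine.baseChange E L).Point

/-- The trace of the `q`-th power Frobenius endomorphism of an elliptic curve `E` over the finite
field `F` with `q` elements, that is, `t = q + 1 - |E(F)|`. -/
noncomputable def frobeniusTrace (E : WeierstrassCurve F) : ℤ :=
  (Fintype.card F : ℤ) + 1 - (Nat.card E.toAffine.Point : ℤ)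

/-- The subfield `{x ∈ Ω | x ^ (q ^ n) = x}` of an extension `Ω` of the field `F` with `q` elements.
If `Ω` is algebraically closed and `n` is positive, this is the field with `q ^ n` elements. -/
def degreeSubfield (F : Type*) [Field F] [Fintype F] (Ω : Type*) [Field Ω] [Algebra F Ω] (n : ℕ) :
    IntermediateField F Ω where
  carrier := {x | x ^ (Fintype.card F ^ n) = x}
  mul_mem' := by
    intro x y hx hy
    simp only [Set.mem_ofPred_eq] at hx hy ⊢
    rw [mul_pow, hx, hy]
  add_mem' := by
    intro x y hx hy
    have key : ∀ z : Ω, (FiniteField.frobeniusAlgHom F Ω ^ n) z = z ^ (Fintype.card F ^ n) := by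
      intro z
      rw [AlgHom.coe_pow, FiniteField.coe_frobeniusAlgHom, pow_iterate]
    simp only [Set.mem_ofPred_eq] at hx hy ⊢
    rw [← key, map_add, key, key, hx, hy]
  algebraMap_mem' := by
    intro r
    have h : (algebraMap F Ω r) ^ (Fintype.card F ^ n) = algebraMap F Ω r := by
      rw [← map_pow, FiniteField.pow_card_pow]
    exact h
  inv_mem' := by
    intro x hx
    simp only [Set.mem_ofPred_eq] at hx ⊢
    rw [inv_pow, hx]

variable (E : WeierstrassCurve F) {L : Type*} [Field L] [Algebra F L] [DecidableEq L]

/-- The `q`-th power Frobenius endomorphism `σ_E` acting on `E(L)`: it raises coordinates to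
the `q`-th power, where `q` is the cardinality of the base field `F`. -/
noncomputable def frob : AddMonoid.End (Pts E L) :=
  WeierstrassCurve.Affine.Point.map (W' := E) (FiniteField.frobeniusAlgHom F L)

/-- The set `{P, σ_E P, …, σ_E ^ (n - 1) P}`; if `σ_E ^ n P = P` and `n` is positive, this is the
orbit of `P` under the group generated by `σ_E`. -/
def orbit (n : ℕ) (P : Pts E L) : Set (Pts E L) :=
  {Q | ∃ j < n, Q = (frob E ^ j) P}

/-- The trace-like endomorphism `P ↦ ∑_{j = 0}^{n - 1} σ_E ^ j P` of `E(L)`. -/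
noncomputable def traceMap (n : ℕ) : Pts E L →+ Pts E L :=
  ∑ j ∈ Finset.range n, (frob E ^ j : AddMonoid.End (Pts E L))

/-- The inclusion `E(K) → E(Ω)` for an intermediate field `K` of `Ω / F`. -/
noncomputable def incl {Ω : Type*} [Field Ω] [Algebra F Ω] [DecidableEq Ω]
    (K : IntermediateField F Ω) : Pts E K →+ Pts E Ω :=
  WeierstrassCurve.Affine.Point.map (W' := E) K.val

end FrobTrace

namespace FrobTrace

open Polynomial

/-- Lifting the exponent at an odd prime `l` exactly dividing `x - 1`. -/
theorem prime_pow_succ_dvd_pow_sub_one_iff {l : ℕ} (hl : l.Prime) (hodd : Odd l) {x : ℤ}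
    (h1 : (l : ℤ) ∣ x - 1) (h2 : ¬ (l : ℤ) ^ 2 ∣ x - 1) (k n : ℕ) :
    (l : ℤ) ^ (k + 1) ∣ x ^ n - 1 ↔ l ^ k ∣ n := by
  have hx : ¬ (l : ℤ) ∣ x := fun h ↦ (Nat.prime_iff_prime_int.mp hl).not_dvd_one <| by
    simpa using dvd_sub h h1
  have hm : emultiplicity (l : ℤ) (x - 1) = 1 := by
    have := emultiplicity_eq_coe (a := (l : ℤ)) (b := x - 1) (n := 1)
    exact_mod_cast this.mpr ⟨by simpa using h1, h2⟩
  have key := Int.emultiplicity_pow_sub_pow hl hodd (x := x) (y := 1) h1 hx n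
  rw [one_pow, hm] at key
  rw [pow_dvd_iff_le_emultiplicity, pow_dvd_iff_le_emultiplicity, key, add_comm (1 : ℕ∞)]
  push_cast
  exact ENat.add_le_add_iff_right (by simp)

/-- The sum `∑ j < l ^ a, x ^ j` is `l ^ a` times an integer prime to `l`. -/
theorem prime_pow_succ_dvd_geom_sum_mul_iff {l : ℕ} (hl : l.Prime) (hodd : Odd l) {x : ℤ}
    (h1 : (l : ℤ) ∣ x - 1) (h2 : ¬ (l : ℤ) ^ 2 ∣ x - 1) (a : ℕ) (y : ℤ) :
    (l : ℤ) ^ (a + 1) ∣ (∑ j ∈ Finset.range (l ^ a), x ^ j) * y ↔ (l : ℤ) ∣ y := by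
  have hp : Prime (l : ℤ) := Nat.prime_iff_prime_int.mp hl
  have hl0 : (l : ℤ) ≠ 0 := hp.ne_zero
  have hg := geom_sum_mul x (l ^ a)
  set S := ∑ j ∈ Finset.range (l ^ a), x ^ j
  obtain ⟨c, hc⟩ := h1
  have hlc : ¬ (l : ℤ) ∣ c := fun ⟨d, hd⟩ ↦ h2 ⟨d, by rw [hc, hd]; ring⟩
  have hS : (l : ℤ) ^ a ∣ S := by
    have hd := (prime_pow_succ_dvd_pow_sub_one_iff hl hodd ⟨c, hc⟩ h2 a (l ^ a)).mpr dvd_rfl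
    rw [← hg, hc, mul_left_comm, pow_succ', mul_dvd_mul_iff_left hl0] at hd
    exact hp.pow_dvd_of_dvd_mul_right a hlc hd
  obtain ⟨s, hs⟩ := hS
  have hls : ¬ (l : ℤ) ∣ s := by
    rintro ⟨d, rfl⟩
    have hd : l ^ (a + 1) ∣ l ^ a :=
      (prime_pow_succ_dvd_pow_sub_one_iff hl hodd ⟨c, hc⟩ h2 (a + 1) (l ^ a)).mp
        ⟨d * c, by rw [← hg, hs, hc]; ring⟩
    exact absurd ((Nat.pow_dvd_pow_iff_le_right hl.one_lt).mp hd) (by omega)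
  rw [hs, mul_assoc, pow_succ, mul_dvd_mul_iff_left (pow_ne_zero _ hl0)]
  exact ⟨fun h ↦ (hp.dvd_or_dvd h).resolve_left hls, fun h ↦ h.mul_left _⟩

/-- Modulo `l ^ (a + 1)`, the powers `x ^ j` with `j < l ^ a` exhaust the residues that are
`1` modulo `l`, hence act transitively on every class of units modulo `l`. -/
theorem exists_pow_mul_sub_dvd {l : ℕ} (hl : l.Prime) (hodd : Odd l) {x : ℤ}
    (h1 : (l : ℤ) ∣ x - 1) (h2 : ¬ (l : ℤ) ^ 2 ∣ x - 1) (a : ℕ) {u v : ℤ}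
    (hu : ¬ (l : ℤ) ∣ u) (huv : (l : ℤ) ∣ u - v) :
    ∃ j < l ^ a, (l : ℤ) ^ (a + 1) ∣ x ^ j * u - v := by
  have hp : Prime (l : ℤ) := Nat.prime_iff_prime_int.mp hl
  have hl0 : (0 : ℤ) < l := by exact_mod_cast hl.pos
  have hx : ¬ (l : ℤ) ∣ x := fun h ↦ hp.not_dvd_one <| by simpa using dvd_sub h h1
  have hpow (j : ℕ) : (l : ℤ) ∣ x ^ j * u - v := by
    have : x ^ j * u - v = (x ^ j - 1) * u + (u - v) := by ring
    rw [this]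
    exact dvd_add ((h1.trans (sub_one_dvd_pow_sub_one x j)).mul_right _) huv
  let f (j : ℕ) : ℤ := ((x ^ j * u - v) / l) % (l : ℤ) ^ a
  have hf (j : ℕ) : (l : ℤ) ^ (a + 1) ∣ x ^ j * u - v - l * f j := by
    obtain ⟨d, hd⟩ := hpow j
    simp only [f, hd]
    rw [Int.mul_ediv_cancel_left _ hl0.ne', ← mul_sub, pow_succ',
      mul_dvd_mul_iff_left hl0.ne']
    exact Int.dvd_self_sub_emod
  have hle {i j : ℕ} (hij : i ≤ j) (hj : j < l ^ a) (hfij : f i = f j) : i = j := by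
    have hd : (l : ℤ) ^ (a + 1) ∣ x ^ i * u * (x ^ (j - i) - 1) := by
      have := dvd_sub (hf j) (hf i)
      rw [hfij] at this
      have e : x ^ j = x ^ i * x ^ (j - i) := by rw [← pow_add, Nat.add_sub_cancel' hij]
      have e' : x ^ i * u * (x ^ (j - i) - 1) =
          x ^ j * u - v - l * f j - (x ^ i * u - v - l * f j) := by rw [e]; ring
      rwa [e']
    have hd' := hp.pow_dvd_of_dvd_mul_left (a + 1)
      (fun h ↦ (hp.dvd_or_dvd h).elim (fun h ↦ hx (hp.dvd_of_dvd_pow h)) hu) hd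
    rw [prime_pow_succ_dvd_pow_sub_one_iff hl hodd h1 h2] at hd'
    have := Nat.eq_zero_of_dvd_of_lt hd' (by omega)
    omega
  have hinj : Set.InjOn f (Finset.range (l ^ a)) := by
    intro i hi j hj hfij
    simp only [Finset.coe_range, Set.mem_Iio] at hi hj
    rcases le_total i j with h | h
    · exact hle h hj hfij
    · exact (hle h hi hfij.symm).symm
  have hmaps : Set.MapsTo f (Finset.range (l ^ a)) (Finset.Ico (0 : ℤ) ((l : ℤ) ^ a)) := by
    intro j _
    simp only [Finset.coe_Ico, Set.mem_Ico]
    exact ⟨Int.emod_nonneg _ (by positivity), Int.emod_lt_of_pos _ (by positivity)⟩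
  have hcard : (Finset.Ico (0 : ℤ) ((l : ℤ) ^ a)).card ≤ (Finset.range (l ^ a)).card := by
    simp only [Int.card_Ico, Finset.card_range, sub_zero]
    exact_mod_cast le_refl _
  have hsurj := Finset.surjOn_of_injOn_of_card_le f hmaps hinj hcard
  obtain ⟨j, hj, hj0⟩ := hsurj (show (0 : ℤ) ∈ _ by simpa using by positivity)
  refine ⟨j, by simpa using hj, ?_⟩
  simpa [hj0] using hf j

theorem incl_injective {F : Type*} [Field F] (E : WeierstrassCurve F) {Ω : Type*} [Field Ω]
    [Algebra F Ω] [DecidableEq Ω] (K : IntermediateField F Ω) :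
    Function.Injective (incl E K) :=
  WeierstrassCurve.Affine.Point.map_injective _

section Frobenius

variable {F : Type*} [Field F] [Fintype F] (E : WeierstrassCurve F)

theorem frob_pow_apply {L : Type*} [Field L] [Algebra F L] [DecidableEq L] (n : ℕ)
    (P : Pts E L) :
    (frob E ^ n) P =
      WeierstrassCurve.Affine.Point.map (W' := E) (FiniteField.frobeniusAlgHom F L ^ n) P := by
  induction n generalizing P with
  | zero => cases P <;> rfl
  | succ n ih =>
    rw [pow_succ, AddMonoid.End.coe_mul, Function.comp_apply, ih, pow_succ]
    exact WeierstrassCurve.Affine.Point.map_map _ _ P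

theorem traceMap_apply {L : Type*} [Field L] [Algebra F L] [DecidableEq L] (n : ℕ)
    (P : Pts E L) : traceMap E n P = ∑ j ∈ Finset.range n, (frob E ^ j) P := by
  rw [traceMap]
  exact AddMonoidHom.finsetSum_apply _ _ _

variable {Ω : Type*} [Field Ω] [Algebra F Ω] [DecidableEq Ω]

theorem incl_frob_pow (K : IntermediateField F Ω) (n : ℕ) (P : Pts E K) :
    incl E K ((frob E ^ n) P) = (frob E ^ n) (incl E K P) := by
  rw [frob_pow_apply, frob_pow_apply, incl, WeierstrassCurve.Affine.Point.map_map,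
    WeierstrassCurve.Affine.Point.map_map]
  congr 2
  ext x
  simp [FiniteField.coe_frobeniusAlgHom, pow_iterate]

theorem incl_traceMap (K : IntermediateField F Ω) (n : ℕ) (P : Pts E K) :
    incl E K (traceMap E n P) = traceMap E n (incl E K P) := by
  simp only [traceMap_apply, map_sum, incl_frob_pow]

theorem image_incl_orbit (K : IntermediateField F Ω) (n : ℕ) (P : Pts E K) :
    incl E K '' orbit E n P = orbit E n (incl E K P) := by
  ext Q
  constructor
  · rintro ⟨_, ⟨j, hj, rfl⟩, rfl⟩
    exact ⟨j, hj, incl_frob_pow E K j P⟩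
  · rintro ⟨j, hj, rfl⟩
    exact ⟨_, ⟨j, hj, rfl⟩, incl_frob_pow E K j P⟩

/-- The points with coordinates in `degreeSubfield F Ω n` are the fixed points of the `n`-th
power of Frobenius. -/
theorem mem_range_incl_degreeSubfield_iff (n : ℕ) (P : Pts E Ω) :
    P ∈ (incl E (degreeSubfield F Ω n)).range ↔ (frob E ^ n) P = P := by
  have hφ (x : Ω) : (FiniteField.frobeniusAlgHom F Ω ^ n) x = x ^ (Fintype.card F ^ n) := by
    rw [AlgHom.coe_pow, FiniteField.coe_frobeniusAlgHom, pow_iterate]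
  rw [frob_pow_apply]
  constructor
  · rintro ⟨Q, rfl⟩
    rw [incl, WeierstrassCurve.Affine.Point.map_map]
    congr 2
    ext x
    exact (hφ _).trans x.2
  · rcases P with _ | ⟨x, y, h⟩
    · exact fun _ ↦ ⟨0, map_zero _⟩
    · intro hP
      rw [WeierstrassCurve.Affine.Point.map_some] at hP
      obtain ⟨hx, hy⟩ := WeierstrassCurve.Affine.Point.some.inj hP
      rw [hφ] at hx hy
      exact ⟨.some ⟨x, hx⟩ ⟨y, hy⟩ ((E.toAffine.baseChange_nonsingular
        (degreeSubfield F Ω n).val.injective _ _).mp h), rfl⟩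

/-- Modulo `m`, the number of rational points is the value of the characteristic polynomial of
Frobenius at `1`. -/
theorem card_point_modEq {m : ℕ} {lam mu : ℕ}
    (hroots : (X ^ 2 - C ((frobeniusTrace E : ℤ) : ZMod m) * X
      + C ((Fintype.card F : ℕ) : ZMod m) : (ZMod m)[X])
      = (X - C (lam : ZMod m)) * (X - C (mu : ZMod m))) :
    (m : ℤ) ∣ Nat.card E.toAffine.Point - ((lam : ℤ) - 1) * (mu - 1) := by
  have h := congrArg (eval 1) hroots
  simp only [frobeniusTrace, eval_add, eval_sub, eval_mul, eval_pow, eval_X, eval_C] at h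
  rw [← ZMod.intCast_zmod_eq_zero_iff_dvd]
  push_cast at h ⊢
  linear_combination h

end Frobenius

section Eigenvector

variable {F : Type*} [Field F] [Fintype F] {E : WeierstrassCurve F}
  {L : Type*} [Field L] [Algebra F L] [DecidableEq L] {P : Pts E L} {c : ℕ}

theorem frob_pow_zsmul (h : frob E P = c • P) (n : ℕ) (x : ℤ) :
    (frob E ^ n) (x • P) = ((c : ℤ) ^ n * x) • P := by
  induction n with
  | zero => simp
  | succ n ih =>
    rw [pow_succ', AddMonoid.End.coe_mul, Function.comp_apply, ih, map_zsmul, h, ← natCast_zsmul, smul_smul]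
    congr 1
    ring

theorem traceMap_zsmul (h : frob E P = c • P) (n : ℕ) (x : ℤ) :
    traceMap E n (x • P) = ((∑ j ∈ Finset.range n, (c : ℤ) ^ j) * x) • P := by
  simp only [traceMap_apply, frob_pow_zsmul h, Finset.sum_mul, Finset.sum_smul]

end Eigenvector

theorem zsmul_eq_zsmul_iff_dvd {A : Type*} [AddCommGroup A] {P : A} {x y : ℤ} :
    x • P = y • P ↔ (addOrderOf P : ℤ) ∣ x - y := by
  rw [addOrderOf_dvd_iff_zsmul_eq_zero, sub_smul, sub_eq_zero]

theorem zsmul_mem_zmultiples_nsmul_iff {A : Type*} [AddCommGroup A] {P : A} {l : ℕ}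
    (hl : l ∣ addOrderOf P) {x : ℤ} :
    x • P ∈ AddSubgroup.zmultiples (l • P) ↔ (l : ℤ) ∣ x := by
  rw [AddSubgroup.mem_zmultiples_iff]
  constructor
  · rintro ⟨k, hk⟩
    rw [← natCast_zsmul, smul_smul, zsmul_eq_zsmul_iff_dvd] at hk
    exact (dvd_sub_right (dvd_mul_left _ _)).mp ((Int.natCast_dvd_natCast.mpr hl).trans hk)
  · rintro ⟨k, rfl⟩
    exact ⟨k, by rw [← natCast_zsmul, smul_smul, mul_comm]⟩

section Orbits

variable {F : Type*} [Field F] [Fintype F] {E : WeierstrassCurve F}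
  {L : Type*} [Field L] [Algebra F L] [DecidableEq L] {P : Pts E L} {l a c : ℕ}

/-- The orbit of a generator consists of the multiples congruent to it modulo `l`. -/
theorem zsmul_mem_orbit_iff (hl : l.Prime) (hodd : Odd l)
    (h1 : (l : ℤ) ∣ (c : ℤ) - 1) (h2 : ¬ (l : ℤ) ^ 2 ∣ (c : ℤ) - 1)
    (hord : addOrderOf P = l ^ (a + 1)) (h : frob E P = c • P) {x y : ℤ} (hx : ¬ (l : ℤ) ∣ x) :
    y • P ∈ orbit E (l ^ a) (x • P) ↔ (l : ℤ) ∣ x - y := by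
  constructor
  · rintro ⟨j, -, hj⟩
    rw [frob_pow_zsmul h, zsmul_eq_zsmul_iff_dvd, hord, Nat.cast_pow] at hj
    have e : x - y = -(y - (c : ℤ) ^ j * x) - ((c : ℤ) ^ j - 1) * x := by ring
    rw [e]
    exact dvd_sub (((dvd_pow_self _ a.succ_ne_zero).trans hj).neg_right)
      ((h1.trans (sub_one_dvd_pow_sub_one _ j)).mul_right _)
  · intro hxy
    obtain ⟨j, hj, hd⟩ := exists_pow_mul_sub_dvd hl hodd h1 h2 a hx hxy
    refine ⟨j, hj, ?_⟩
    rw [frob_pow_zsmul h, eq_comm, zsmul_eq_zsmul_iff_dvd, hord, Nat.cast_pow]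
    exact hd

theorem traceMap_eq_iff_orbit_eq (hl : l.Prime) (hodd : Odd l)
    (h1 : (l : ℤ) ∣ (c : ℤ) - 1) (h2 : ¬ (l : ℤ) ^ 2 ∣ (c : ℤ) - 1)
    (hord : addOrderOf P = l ^ (a + 1)) (h : frob E P = c • P) {x y : ℤ}
    (hx : ¬ (l : ℤ) ∣ x) (hy : ¬ (l : ℤ) ∣ y) :
    traceMap E (l ^ a) (x • P) = traceMap E (l ^ a) (y • P) ↔
      orbit E (l ^ a) (x • P) = orbit E (l ^ a) (y • P) := by
  rw [traceMap_zsmul h, traceMap_zsmul h, zsmul_eq_zsmul_iff_dvd, hord, Nat.cast_pow, ← mul_sub,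
    prime_pow_succ_dvd_geom_sum_mul_iff hl hodd h1 h2]
  constructor
  · intro hxy
    have hmul {u : ℤ} {Q : Pts E L} (hQ : Q ∈ orbit E (l ^ a) (u • P)) : ∃ z : ℤ, Q = z • P := by
      obtain ⟨j, -, rfl⟩ := hQ
      exact ⟨_, frob_pow_zsmul h j u⟩
    ext Q
    constructor
    · intro hQ
      obtain ⟨z, rfl⟩ := hmul hQ
      rw [zsmul_mem_orbit_iff hl hodd h1 h2 hord h hx] at hQ
      rw [zsmul_mem_orbit_iff hl hodd h1 h2 hord h hy]
      simpa using dvd_sub hQ hxy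
    · intro hQ
      obtain ⟨z, rfl⟩ := hmul hQ
      rw [zsmul_mem_orbit_iff hl hodd h1 h2 hord h hy] at hQ
      rw [zsmul_mem_orbit_iff hl hodd h1 h2 hord h hx]
      simpa using dvd_add hxy hQ
  · intro ho
    rw [← zsmul_mem_orbit_iff hl hodd h1 h2 hord h hx, ho,
      zsmul_mem_orbit_iff hl hodd h1 h2 hord h hy]
    simp

theorem disjoint_orbit (hl : l.Prime) (hodd : Odd l)
    (h1 : (l : ℤ) ∣ (c : ℤ) - 1) (h2 : ¬ (l : ℤ) ^ 2 ∣ (c : ℤ) - 1)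
    (hord : addOrderOf P = l ^ (a + 1)) (h : frob E P = c • P) {x y : ℤ}
    (hx : ¬ (l : ℤ) ∣ x) (hy : ¬ (l : ℤ) ∣ y) (hxy : ¬ (l : ℤ) ∣ x - y) :
    Disjoint (orbit E (l ^ a) (x • P)) (orbit E (l ^ a) (y • P)) := by
  refine Set.disjoint_left.mpr fun Q hQx hQy ↦ hxy ?_
  obtain ⟨j, -, hj⟩ := id hQx
  rw [frob_pow_zsmul h] at hj
  subst hj
  rw [zsmul_mem_orbit_iff hl hodd h1 h2 hord h hx] at hQx
  rw [zsmul_mem_orbit_iff hl hodd h1 h2 hord h hy] at hQy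
  simpa using dvd_sub hQx hQy

theorem zmultiples_diff_eq_iUnion_orbit (hl : l.Prime) (hodd : Odd l)
    (h1 : (l : ℤ) ∣ (c : ℤ) - 1) (h2 : ¬ (l : ℤ) ^ 2 ∣ (c : ℤ) - 1)
    (hord : addOrderOf P = l ^ (a + 1)) (h : frob E P = c • P) :
    (AddSubgroup.zmultiples P : Set (Pts E L)) \ AddSubgroup.zmultiples (l • P)
      = ⋃ z ∈ Finset.Icc 1 (l - 1), orbit E (l ^ a) (z • P) := by
  have hdvd : l ∣ addOrderOf P := hord ▸ dvd_pow_self _ a.succ_ne_zero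
  have hl0 : (l : ℤ) ≠ 0 := by exact_mod_cast hl.ne_zero
  have hz {z : ℕ} (hz : z ∈ Finset.Icc 1 (l - 1)) : ¬ (l : ℤ) ∣ z := by
    rw [Finset.mem_Icc] at hz
    rw [Int.natCast_dvd_natCast]
    exact Nat.not_dvd_of_pos_of_lt hz.1 (by have := hl.pos; omega)
  ext Q
  simp only [Set.mem_sdiff, SetLike.mem_coe, Set.mem_iUnion, exists_prop]
  constructor
  · rintro ⟨⟨x, rfl⟩, hx⟩
    simp only at hx ⊢
    rw [zsmul_mem_zmultiples_nsmul_iff hdvd] at hx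
    have hpos : 0 ≤ x % l := Int.emod_nonneg _ hl0
    have hlt : x % l < l := Int.emod_lt_of_pos _ (by exact_mod_cast hl.pos)
    have hne : x % l ≠ 0 := fun h0 ↦ hx (Int.dvd_of_emod_eq_zero h0)
    have hmem : (x % l).toNat ∈ Finset.Icc 1 (l - 1) := by
      rw [Finset.mem_Icc]
      omega
    refine ⟨_, hmem, ?_⟩
    rw [← natCast_zsmul, zsmul_mem_orbit_iff hl hodd h1 h2 hord h (hz hmem),
      Int.toNat_of_nonneg hpos, dvd_sub_comm]
    exact Int.dvd_self_sub_emod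
  · rintro ⟨z, hzmem, hQ⟩
    rw [← natCast_zsmul] at hQ
    obtain ⟨j, -, hj⟩ := id hQ
    rw [frob_pow_zsmul h] at hj
    subst hj
    refine ⟨⟨_, rfl⟩, ?_⟩
    rw [zsmul_mem_orbit_iff hl hodd h1 h2 hord h (hz hzmem)] at hQ
    rw [zsmul_mem_zmultiples_nsmul_iff hdvd]
    exact fun hd ↦ hz hzmem ((dvd_sub_left hd).mp hQ)

end Orbits

end FrobTrace

open Polynomial FrobTrace in
theorem lemma5p4
    {F : Type*} [Field F] [Fintype F]
    {Ω : Type*} [Field Ω] [Algebra F Ω] [IsAlgClosure F Ω] [DecidableEq Ω]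
    (l a : ℕ) (hl : l.Prime) (ha : 0 < a)
    (hlq : ¬ l ∣ Fintype.card F * (Fintype.card F - 1))
    (E : WeierstrassCurve F) [E.IsElliptic]
    (hE : l ∣ Nat.card E.toAffine.Point) (hE2 : ¬ l ^ 2 ∣ Nat.card E.toAffine.Point)
    -- the two roots modulo `l ^ (a + 1)` of the characteristic polynomial of Frobenius
    (lam mu : ℕ) (hlam : lam < l ^ (a + 1)) (hmu : mu < l ^ (a + 1))
    (hlam1 : lam ≡ 1 [MOD l]) (hmuq : mu ≡ Fintype.card F [MOD l])
    (hroots : (X ^ 2 - C ((frobeniusTrace E : ℤ) : ZMod (l ^ (a + 1))) * X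
        + C ((Fintype.card F : ℕ) : ZMod (l ^ (a + 1))) : (ZMod (l ^ (a + 1)))[X])
      = (X - C (lam : ZMod (l ^ (a + 1)))) * (X - C (mu : ZMod (l ^ (a + 1)))))
    -- the chosen eigenvectors, which split the `l ^ (a + 1)`-torsion
    (Plam Pmu : Pts E Ω)
    (hordlam : addOrderOf Plam = l ^ (a + 1)) (hordmu : addOrderOf Pmu = l ^ (a + 1))
    (hspan : AddSubgroup.torsionBy (Pts E Ω) ((l ^ (a + 1) : ℕ) : ℤ)
      = AddSubgroup.zmultiples Plam ⊔ AddSubgroup.zmultiples Pmu)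
    (hdisj : Disjoint (AddSubgroup.zmultiples Plam) (AddSubgroup.zmultiples Pmu))
    (hfroblam : frob E Plam = lam • Plam) (hfrobmu : frob E Pmu = mu • Pmu) :
    -- the trace separates the orbits
    (∀ P₁ P₂ : Pts E (degreeSubfield F Ω (l ^ a)),
      incl E (degreeSubfield F Ω (l ^ a)) P₁ ∈
        (AddSubgroup.zmultiples Plam : Set (Pts E Ω)) \ AddSubgroup.zmultiples (l • Plam) →
      incl E (degreeSubfield F Ω (l ^ a)) P₂ ∈
        (AddSubgroup.zmultiples Plam : Set (Pts E Ω)) \ AddSubgroup.zmultiples (l • Plam) →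
      (traceMap E (l ^ a) P₁ = traceMap E (l ^ a) P₂ ↔
        orbit E (l ^ a) P₁ = orbit E (l ^ a) P₂)) ∧
    -- the rational `l ^ (a + 1)`-torsion is generated by `Plam`
    (incl E (degreeSubfield F Ω (l ^ a))).range ⊓
        AddSubgroup.torsionBy (Pts E Ω) ((l ^ (a + 1) : ℕ) : ℤ)
      = AddSubgroup.zmultiples Plam ∧
    -- the disjoint decomposition into orbits
    (AddSubgroup.zmultiples Plam : Set (Pts E Ω)) \ AddSubgroup.zmultiples (l • Plam)
      = ⋃ z ∈ Finset.Icc 1 (l - 1), orbit E (l ^ a) (z • Plam) ∧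
    (∀ z₁ ∈ Finset.Icc 1 (l - 1), ∀ z₂ ∈ Finset.Icc 1 (l - 1), z₁ ≠ z₂ →
      Disjoint (orbit E (l ^ a) (z₁ • Plam)) (orbit E (l ^ a) (z₂ • Plam))) := by
  have hq : ¬ l ∣ Fintype.card F - 1 := fun h ↦ hlq (h.mul_left _)
  have hodd : Odd l := by
    refine hl.odd_of_ne_two fun h2 ↦ hlq ?_
    subst h2
    exact even_iff_two_dvd.mp (Nat.even_mul_pred_self _)
  have hp : Prime (l : ℤ) := Nat.prime_iff_prime_int.mp hl
  have h1 : (l : ℤ) ∣ (lam : ℤ) - 1 := by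
    simpa using (Nat.modEq_iff_dvd.mp hlam1.symm)
  have hmu1 : ¬ (l : ℤ) ∣ (mu : ℤ) - 1 := by
    intro h
    have h' := dvd_add h (Nat.modEq_iff_dvd.mp hmuq)
    have e : (mu : ℤ) - 1 + ((Fintype.card F : ℤ) - mu) = ((Fintype.card F - 1 : ℕ) : ℤ) := by
      rw [Nat.cast_sub Fintype.card_pos]
      push_cast
      ring
    rw [e, Int.natCast_dvd_natCast] at h'
    exact hq h'
  have h2 : ¬ (l : ℤ) ^ 2 ∣ (lam : ℤ) - 1 := by
    intro h
    have hc := card_point_modEq E hroots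
    rw [Nat.cast_pow] at hc
    have hc' := (dvd_sub_left (h.mul_right _)).mp
      ((pow_dvd_pow (l : ℤ) (show 2 ≤ a + 1 by omega)).trans hc)
    exact hE2 (by exact_mod_cast hc')
  have hdvd : l ∣ addOrderOf Plam := hordlam ▸ dvd_pow_self _ a.succ_ne_zero
  have hz {z : ℕ} (hz : z ∈ Finset.Icc 1 (l - 1)) : 1 ≤ z ∧ z < l := by
    rw [Finset.mem_Icc] at hz
    have := hl.pos
    omega
  have hzl {z : ℕ} (hzm : z ∈ Finset.Icc 1 (l - 1)) : ¬ (l : ℤ) ∣ z := by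
    rw [Int.natCast_dvd_natCast]
    exact Nat.not_dvd_of_pos_of_lt (hz hzm).1 (hz hzm).2
  have hfix (x : ℤ) : (frob E ^ (l ^ a)) (x • Plam) = x • Plam := by
    rw [frob_pow_zsmul hfroblam, zsmul_eq_zsmul_iff_dvd, hordlam, Nat.cast_pow, ← sub_one_mul]
    exact ((prime_pow_succ_dvd_pow_sub_one_iff hl hodd h1 h2 a _).mpr dvd_rfl).mul_right _
  refine ⟨?_, ?_, zmultiples_diff_eq_iUnion_orbit hl hodd h1 h2 hordlam hfroblam, ?_⟩
  · rintro P₁ P₂ ⟨⟨x, hx⟩, hx'⟩ ⟨⟨y, hy⟩, hy'⟩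
    simp only at hx hy
    rw [SetLike.mem_coe, ← hx, zsmul_mem_zmultiples_nsmul_iff hdvd] at hx'
    rw [SetLike.mem_coe, ← hy, zsmul_mem_zmultiples_nsmul_iff hdvd] at hy'
    rw [← (incl_injective E _).eq_iff, incl_traceMap, incl_traceMap,
      ← (incl_injective E _).image_injective.eq_iff, image_incl_orbit, image_incl_orbit,
      ← hx, ← hy]
    exact traceMap_eq_iff_orbit_eq hl hodd h1 h2 hordlam hfroblam hx' hy'
  · ext Q
    rw [AddSubgroup.mem_inf, mem_range_incl_degreeSubfield_iff, hspan]
    constructor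
    · rintro ⟨hQ, hmem⟩
      obtain ⟨_, ⟨x, rfl⟩, _, ⟨y, rfl⟩, rfl⟩ := AddSubgroup.mem_sup.mp hmem
      simp only at hQ ⊢
      rw [map_add, hfix, add_right_inj, frob_pow_zsmul hfrobmu, zsmul_eq_zsmul_iff_dvd, hordmu,
        Nat.cast_pow, ← sub_one_mul] at hQ
      have hmul : ¬ (l : ℤ) ∣ (mu : ℤ) ^ l ^ a - 1 := by
        have := Fact.mk hl
        intro hd
        rw [← ZMod.intCast_zmod_eq_zero_iff_dvd] at hmu1 hd
        push_cast at hmu1 hd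
        rw [ZMod.pow_card_pow] at hd
        exact hmu1 hd
      have hy : y • Pmu = 0 := by
        rw [← addOrderOf_dvd_iff_zsmul_eq_zero, hordmu, Nat.cast_pow]
        exact hp.pow_dvd_of_dvd_mul_left _ hmul hQ
      rw [hy, add_zero]
      exact ⟨x, rfl⟩
    · rintro ⟨x, rfl⟩
      exact ⟨hfix x, AddSubgroup.mem_sup_left ⟨x, rfl⟩⟩
  · intro z₁ hz₁ z₂ hz₂ hne
    rw [← natCast_zsmul, ← natCast_zsmul]
    refine disjoint_orbit hl hodd h1 h2 hordlam hfroblam (hzl hz₁) (hzl hz₂) fun hd ↦ hne ?_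
    exact ((Nat.modEq_iff_dvd.mpr hd).eq_of_lt_of_lt (hz hz₂).2 (hz hz₁).2).symm
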